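/- Let $n\in\mathbb N$ and $0<s<1$. Matrices in $\mathbb{R}^{n\times n}$ carry the operator norm $\|M\|=\sup_{\|x\|=1}\|Mx\|$ for the Euclidean norm on $\mathbb{R}^n$, and for a symmetric positive definite $A=\sum_k\lambda_k\langle a_k,\cdot\rangle a_k$ (with $(a_k)$ an orthonormal basis of eigenvectors) one sets $A^s=\sum_k\lambda_k^s\langle a_k,\cdot\rangle a_k$. (1) Let $A,B\in\mathbb{R}^{n\times n}$ be symmetric positive definite with $\|AB\|=1$, and let $v\in\mathbb{R}^n$ satisfy $\|v\|=1$ and $\|A^sB^sv\|=1$ $(=\|AB\|^s)$. For real $\mu$ let $\pi_\mu$ be the orthogonal projection onto the eigenspace $\ker(B-\mu I)$. If $\pi_\mu v\neq 0$, then $\pi_\mu v$ is an eigenvector of $A$ with eigenvalue $1/\mu$. (2) For symmetric positive definite $A,B\in\mathbb{R}^{n\times n}$ with spectra $\sigma(A),\sigma(B)$ let $$d^*(A,B)=\min_{\lambda,\lambda'\in\sigma(A),\,\mu\in\sigma(B)}\left|\log\lambda+\log\lambda'+2\log\mu\right|+\min_{\lambda\in\sigma(A),\,\mu,\mu'\in\sigma(B)}\left|2\log\lambda+\log\mu+\log\mu'\right|.$$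 For every $d^*>0$ there is a constant $c_{n,s,d^*}>0$, depending only on $n$, $s$ and $d^*$, such that for all symmetric positive definite $A,B\in\mathbb{R}^{n\times n}$ with $\|AB\|=1$ and $d^*(A,B)=d^*$, $$\|A^sB^s\|\le(1-c_{n,s,d^*})\,\|AB\|^s.$$ -/

import Mathlib

open scoped Matrix Matrix.Norms.L2Operator

noncomputable section

/-- The real power `A ^ s = ∑ₖ λₖ ^ s ⟨aₖ, ·⟩ aₖ` of a symmetric positive definite matrix
`A = ∑ₖ λₖ ⟨aₖ, ·⟩ aₖ`, through the continuous functional calculus. -/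
def matPow {n : ℕ} (A : Matrix (Fin n) (Fin n) ℝ) (s : ℝ) : Matrix (Fin n) (Fin n) ℝ :=
  cfc (fun x : ℝ => x ^ s) A

/-- The spectral projector `π_μ` of a symmetric matrix `B`: the orthogonal projection of `ℝⁿ` onto
the eigenspace of `B` for `μ` (the zero map if `μ` is not an eigenvalue of `B`). -/
def specProj {n : ℕ} (B : Matrix (Fin n) (Fin n) ℝ) (μ : ℝ) :
    EuclideanSpace ℝ (Fin n) →L[ℝ] EuclideanSpace ℝ (Fin n) :=
  (Module.End.eigenspace (Matrix.toEuclideanCLM (n := Fin n) (𝕜 := ℝ) B).toLinearMap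
    μ).starProjection

/-- The separation `d*` of the spectra of `A` and `B`. Each infimum is taken over a finite set of
reals, which is nonempty for `n ≥ 1` and symmetric `A`, `B`, so it is a minimum. -/
def dStar {n : ℕ} (A B : Matrix (Fin n) (Fin n) ℝ) : ℝ :=
  sInf {x : ℝ | ∃ l ∈ spectrum ℝ A, ∃ l' ∈ spectrum ℝ A, ∃ m ∈ spectrum ℝ B,
      x = |Real.log l + Real.log l' + 2 * Real.log m|} +
  sInf {x : ℝ | ∃ l ∈ spectrum ℝ A, ∃ m ∈ spectrum ℝ B, ∃ m' ∈ spectrum ℝ B,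
      x = |2 * Real.log l + Real.log m + Real.log m'|}

end

/-!
The proof studies `A ^ z B ^ z` for complex `z`. In orthonormal eigenbases `aᵢ`, `bⱼ` with eigenvalues
`e ^ αᵢ`, `e ^ βⱼ` it is the matrix `E(z)` with entries `e ^ (z (αᵢ + βⱼ)) ⟨aᵢ, bⱼ⟩`, an entire function
of `z`. On a vertical line `E` changes only by unitary factors, so the three lines theorem gives
`‖E(z)‖ ≤ 1` for `0 ≤ Re z ≤ 1` when `‖A B‖ = 1` (`norm_expSandwich_le_one`).

*Equality case.* If `‖E(s) y‖ = ‖y‖` for one `s` in `(0, 1)`, the maximum principle in a strictly convex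
space makes `z ↦ E(z) y` constant on the strip. Its `i`-th coordinate is an exponential sum with
frequencies `αᵢ + βⱼ`, and exponentials are linearly independent, so the coefficients belonging to a
nonzero frequency cancel (`sum_fiber_eq_zero_of_norm_expSandwich_eq`). This says that `⟨aᵢ, π_μ v⟩ = 0`
unless `e ^ αᵢ = 1 / μ`, so `π_μ v` lies in the eigenspace of `A` for `1 / μ`.

*Gap.* For a real vector `y` put `F(z) = ∑ᵢ (E(z) y)ᵢ ^ 2`. Then `F(s) = ‖E(s) y‖ ^ 2`, `Re F ≤ ‖y‖ ^ 2`
on the strip, and `F` is an exponential sum of at most `n ^ 3` terms with frequencies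
`2 αᵢ + βⱼ + βⱼ'`. If these have absolute value at least `δ`, then averaging over half periods shows
that `Re F ≤ 0` at some point `s + i τ` with `0 ≤ τ ≤ n ^ 3 π / δ` (`exists_re_expSum_nonpos`).
Harnack's inequality for the nonnegative harmonic function `‖y‖ ^ 2 - Re F`, applied along a chain of
`k` discs from `s + i τ` to `s` (`re_le_three_pow_mul_re`), gives
`‖y‖ ^ 2 ≤ 3 ^ k (‖y‖ ^ 2 - F(s))`, where `k` depends only on `n`, `s` and `δ`. Since `d*` is a sum of
two terms, one of them is at least `d* / 2`, and this is the frequency bound for `A B` or for `B A`.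
-/

/-! ### Harnack's inequality along a vertical line -/

open Complex in
/-- Harnack's inequality on the disc of half the radius, for the real part of a holomorphic function.
It is the Borel–Carathéodory estimate for `i Im f(c) - f`, whose value at the centre is `-Re f(c)`,
with an upper bound for the real part that tends to `0`. -/
theorem re_le_three_mul_re_of_re_nonneg {f : ℂ → ℂ} {c z : ℂ} {R : ℝ} (hR : 0 < R)
    (hf : DifferentiableOn ℂ f (Metric.ball c R)) (hre : ∀ w ∈ Metric.ball c R, 0 ≤ (f w).re)
    (hz : ‖z - c‖ ≤ R / 2) : (f z).re ≤ 3 * (f c).re := by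
  refine le_of_forall_pos_le_add fun ε hε => ?_
  set g : ℂ → ℂ := fun w => (f c).im * I - f (w + c) with hg
  have hmaps : Set.MapsTo (fun w : ℂ => w + c) (Metric.ball 0 R) (Metric.ball c R) := by
    intro w hw
    simpa using hw
  have hgd : DifferentiableOn ℂ g (Metric.ball 0 R) :=
    (differentiableOn_const _).sub (hf.comp (by fun_prop) hmaps)
  have hgM : Set.MapsTo g (Metric.ball 0 R) {w | w.re ≤ ε / 2} := by
    intro w hw
    have := hre _ (hmaps hw)
    simp [hg]
    linarith
  have hzR : ‖z - c‖ < R := by linarith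
  have key := borelCaratheodory (M := ε / 2) (R := R) (z := z - c) (f := g) (by positivity) hgd hgM
    hR (by simpa using hzR)
  have h0 : ‖g 0‖ = (f c).re := by
    have h : g 0 = ((-(f c).re : ℝ) : ℂ) := by
      apply Complex.ext <;> simp [hg]
    rw [h, norm_real, Real.norm_eq_abs, abs_neg, abs_of_nonneg]
    exact hre c (by simpa using hR)
  have hd : 0 < R - ‖z - c‖ := by linarith
  have hge : (f z).re ≤ ‖g (z - c)‖ := by
    have h1 := neg_le_of_abs_le (abs_re_le_norm (g (z - c)))
    simp [hg] at h1
    simpa [hg] using h1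
  have hc : 0 ≤ (f c).re := hre c (by simpa using hR)
  have h1 : 2 * (ε / 2) * ‖z - c‖ / (R - ‖z - c‖) ≤ ε := by
    rw [div_le_iff₀ hd]; nlinarith
  have h2 : ‖g 0‖ * (R + ‖z - c‖) / (R - ‖z - c‖) ≤ 3 * (f c).re := by
    rw [h0, div_le_iff₀ hd]; nlinarith
  linarith

open Complex in
/-- Harnack's inequality for two points of the line `Re z = s`, at distance at most `k * (r / 2)`,
by a chain of `k` discs of radius `r`. -/
theorem re_le_three_pow_mul_re {f : ℂ → ℂ} (hf : Differentiable ℂ f) {s r : ℝ} (hr : 0 < r)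
    (hre : ∀ w : ℂ, |w.re - s| < r → 0 ≤ (f w).re) (k : ℕ) :
    ∀ t τ : ℝ, |τ| ≤ k * (r / 2) →
      (f (s + (t + τ : ℝ) * I)).re ≤ 3 ^ k * (f (s + t * I)).re := by
  induction k with
  | zero =>
    intro t τ h
    have : τ = 0 := by simpa using h
    simp [this]
  | succ k ih =>
    intro t τ h
    have hk : (0 : ℝ) < k + 1 := by positivity
    push_cast at h
    -- The shift `τ` is made of `k + 1` equal steps of length at most `r / 2`.
    have h1 : |τ * (k / (k + 1))| ≤ k * (r / 2) := by
      rw [abs_mul, abs_of_nonneg (by positivity : (0 : ℝ) ≤ k / (k + 1)), mul_div_assoc',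
        div_le_iff₀ hk]
      nlinarith [mul_le_mul_of_nonneg_right h (Nat.cast_nonneg (α := ℝ) k)]
    have h2 : |τ / (k + 1)| ≤ r / 2 := by
      rw [abs_div, abs_of_pos hk, div_le_iff₀ hk]
      linarith
    have h3 := ih (t + τ / (k + 1)) (τ * (k / (k + 1))) h1
    have h4 : t + τ / (k + 1) + τ * (k / (k + 1)) = t + τ := by
      field_simp
      ring
    rw [h4] at h3
    have h5 : (f (s + (t + τ / (k + 1) : ℝ) * I)).re ≤ 3 * (f (s + t * I)).re := by
      refine re_le_three_mul_re_of_re_nonneg hr hf.differentiableOn (fun w hw => hre w ?_) ?_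
      · have := abs_re_le_norm (w - (s + t * I))
        rw [mem_ball_iff_norm] at hw
        simp at this
        linarith
      · have h6 : (s + (t + τ / (k + 1) : ℝ) * I - (s + t * I) : ℂ)
            = ((τ / (k + 1) : ℝ) : ℂ) * I := by
          push_cast; ring
        rw [h6, norm_mul, norm_real, norm_I, mul_one]
        exact h2
    calc _ ≤ _ := h3
      _ ≤ 3 ^ k * (3 * (f (s + t * I)).re) := by gcongr
      _ = _ := by ring

/-! ### Exponential sums with real frequencies -/

open Complex in
/-- An exponential sum without frequencies in `(-δ, δ)` cannot keep a positive real part on a segment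
of length `π / δ` times the number of its terms: adding to the sum its translate by half a period of
one of the terms removes that term, and preserves positivity on a segment shorter by the shift. -/
theorem exists_re_expSum_nonpos {κ : Type*} (S : Finset κ) (ω : κ → ℝ) {δ : ℝ} (hδ : 0 < δ)
    (hω : ∀ k ∈ S, δ ≤ |ω k|) : ∀ c : κ → ℂ,
    ∃ τ : ℝ, 0 ≤ τ ∧ τ ≤ S.card * (Real.pi / δ) ∧
      (∑ k ∈ S, c k * exp (τ * I * ω k)).re ≤ 0 := by
  classical
  induction S using Finset.induction_on with
  | empty => exact fun c => ⟨0, by simp⟩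
  | insert a S ha ih =>
    intro c
    have hωa : δ ≤ |ω a| := hω a (Finset.mem_insert_self a S)
    have ha0 : 0 < |ω a| := hδ.trans_le hωa
    have hpi : Real.pi / |ω a| ≤ Real.pi / δ := by gcongr
    have hpi0 : 0 < Real.pi / |ω a| := by positivity
    set p : ℝ := Real.pi / |ω a| with hp
    obtain ⟨τ, h0, h1, h2⟩ := ih (fun k hk => hω k (Finset.mem_insert_of_mem hk))
      (fun k => c k * (1 + exp (p * I * ω k)))
    -- Half a period kills the frequency `ω a`.
    have hexp : exp (p * I * ω a) = -1 := by
      have hne : ω a ≠ 0 := abs_pos.1 ha0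
      rcases abs_choice (ω a) with h | h
      · have : (p * I * ω a : ℂ) = Real.pi * I := by
          rw [show (p * I * ω a : ℂ) = ((p * ω a : ℝ) : ℂ) * I by push_cast; ring]
          congr 2
          rw [hp, h]; field_simp
        rw [this, exp_pi_mul_I]
      · have : (p * I * ω a : ℂ) = -(Real.pi * I) := by
          rw [show (p * I * ω a : ℂ) = ((p * ω a : ℝ) : ℂ) * I by push_cast; ring, ← neg_mul,
            ← ofReal_neg]
          congr 2
          rw [hp, h]; field_simp
        rw [this, exp_neg, exp_pi_mul_I]; norm_num
    have hsum : ∑ k ∈ S, c k * (1 + exp (p * I * ω k)) * exp (τ * I * ω k)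
        = ∑ k ∈ insert a S, c k * exp (τ * I * ω k)
          + ∑ k ∈ insert a S, c k * exp ((τ + p : ℝ) * I * ω k) := by
      have hsplit : ∀ k, c k * exp (τ * I * ω k) + c k * exp ((τ + p : ℝ) * I * ω k)
          = c k * (1 + exp (p * I * ω k)) * exp (τ * I * ω k) := by
        intro k
        rw [show ((τ + p : ℝ) * I * ω k : ℂ) = p * I * ω k + τ * I * ω k by push_cast; ring,
          exp_add]
        ring
      rw [← Finset.sum_add_distrib, Finset.sum_congr rfl fun k _ => hsplit k,
        Finset.sum_insert ha, hexp]
      simp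
    rw [hsum, add_re] at h2
    rw [Finset.card_insert_of_notMem ha]
    push_cast
    rcases le_total (∑ k ∈ insert a S, c k * exp (τ * I * ω k)).re 0 with h | h
    · exact ⟨τ, h0, by nlinarith, h⟩
    · exact ⟨τ + p, by linarith, by nlinarith, by linarith⟩

open Complex in
/-- In a constant exponential sum the coefficients belonging to any one nonzero frequency add up
to `0`, by the linear independence of the characters `τ ↦ e ^ (i τ x)` of `ℝ`. -/
theorem sum_fiber_eq_zero_of_expSum_const {κ : Type*} [Fintype κ] (c : κ → ℂ) (ω : κ → ℝ) (C : ℂ)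
    (h : ∀ τ : ℝ, ∑ k, c k * exp (τ * I * ω k) = C) {w : ℝ} (hw : w ≠ 0) :
    ∑ k with ω k = w, c k = 0 := by
  classical
  let χ : ℝ → (Multiplicative ℝ →* ℂ) := fun x =>
    { toFun := fun τ => exp ((Multiplicative.toAdd τ : ℝ) * I * x)
      map_one' := by simp
      map_mul' := fun a b => by
        rw [← exp_add]; congr 1; simp; ring }
  have hχ : Function.Injective χ := by
    intro x y hxy
    by_contra hne
    have hsub : x - y ≠ 0 := sub_ne_zero.2 hne
    have h1 : exp ((Real.pi / (x - y) : ℝ) * I * x) = exp ((Real.pi / (x - y) : ℝ) * I * y) :=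
      DFunLike.congr_fun hxy (Multiplicative.ofAdd (Real.pi / (x - y)))
    have h2 : ((Real.pi / (x - y) : ℝ) * I * x : ℂ)
        = Real.pi * I + (Real.pi / (x - y) : ℝ) * I * y := by
      have : (Real.pi : ℂ) = ((Real.pi / (x - y) * (x - y) : ℝ) : ℂ) := by
        rw [div_mul_cancel₀ _ hsub]
      rw [this]; push_cast; ring
    rw [h2, exp_add, exp_pi_mul_I] at h1
    have h3 := exp_ne_zero ((Real.pi / (x - y) : ℝ) * I * y)
    apply h3
    linear_combination (-1 / 2 : ℂ) * h1
  have hli : LinearIndependent ℂ (fun x : ℝ => (χ x : Multiplicative ℝ → ℂ)) :=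
    (linearIndependent_monoidHom (Multiplicative ℝ) ℂ).comp χ hχ
  set T : Finset ℝ := insert w (insert 0 (Finset.univ.image ω)) with hT
  have key := linearIndependent_iff'.1 hli T
    (fun x => ∑ k with ω k = x, c k - if x = 0 then C else 0) ?_ w (by simp [hT])
  · simpa [hw] using key
  · funext τ
    set t : ℝ := Multiplicative.toAdd τ
    have h1 : ∑ x ∈ T, (∑ k with ω k = x, c k) * exp (t * I * x) = C := by
      rw [← h t, ← Finset.sum_fiberwise_of_maps_to (t := T) (g := ω)
        (fun k _ => by simp [hT])]
      refine Finset.sum_congr rfl fun x _ => ?_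
      rw [Finset.sum_mul]
      refine Finset.sum_congr rfl fun k hk => ?_
      rw [(Finset.mem_filter.1 hk).2]
    have h2 : ∑ x ∈ T, (if x = 0 then C else 0) * exp (t * I * x) = C := by
      rw [Finset.sum_eq_single 0]
      · simp
      · intro b _ hb; simp [hb]
      · intro hb; exact absurd (by simp [hT]) hb
    have h3 : ∀ x, (χ x) τ = exp (t * I * x) := fun x => rfl
    simp only [Finset.sum_apply, Pi.smul_apply, smul_eq_mul, h3, sub_mul,
      Finset.sum_sub_distrib, h1, h2, sub_self, Pi.zero_apply]

/-! ### Complex powers in eigencoordinates -/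

theorem norm_toLp_ofReal {ι : Type*} [Fintype ι] (y : ι → ℝ) :
    ‖WithLp.toLp 2 (fun i => (y i : ℂ))‖ = ‖WithLp.toLp 2 y‖ := by
  simp [EuclideanSpace.norm_eq]

theorem map_ofReal_mulVec {ι : Type*} [Fintype ι] (M : Matrix ι ι ℝ) (y : ι → ℝ) :
    (M.map ((↑) : ℝ → ℂ) *ᵥ fun i => (y i : ℂ)) = fun i => ((M *ᵥ y) i : ℂ) := by
  funext i
  exact (RingHom.map_mulVec Complex.ofRealHom M y i).symm

/-- The complexification of a real matrix has no larger operator norm: the real and imaginary parts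
of a vector are transformed separately, and their squared norms add up. -/
theorem norm_map_ofReal_le {ι : Type*} [Fintype ι] [DecidableEq ι] (K : Matrix ι ι ℝ) :
    ‖K.map ((↑) : ℝ → ℂ)‖ ≤ ‖K‖ := by
  rw [← Matrix.l2_opNorm_toEuclideanCLM]
  refine ContinuousLinearMap.opNorm_le_bound _ (norm_nonneg _) fun x => ?_
  have hpyth : ∀ x : EuclideanSpace ℂ ι, ‖x‖ ^ 2
      = ‖WithLp.toLp 2 (fun i => (x i).re)‖ ^ 2 + ‖WithLp.toLp 2 (fun i => (x i).im)‖ ^ 2 := by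
    intro x
    simp only [EuclideanSpace.norm_sq_eq, ← Finset.sum_add_distrib]
    refine Finset.sum_congr rfl fun i _ => ?_
    rw [← Complex.normSq_eq_norm_sq, Complex.normSq_apply]
    simp [sq]
  have hK : ∀ y : ι → ℝ, ‖WithLp.toLp 2 (K *ᵥ y)‖ ≤ ‖K‖ * ‖WithLp.toLp 2 y‖ :=
    fun y => K.l2_opNorm_mulVec (WithLp.toLp 2 y)
  refine (sq_le_sq₀ (by positivity) (by positivity)).1 ?_
  have h1 : (fun i => (Matrix.toEuclideanCLM (n := ι) (𝕜 := ℂ) (K.map (↑)) x i).re)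
      = K *ᵥ fun i => (x i).re := by
    funext i
    simp [Matrix.mulVec, dotProduct]
  have h2 : (fun i => (Matrix.toEuclideanCLM (n := ι) (𝕜 := ℂ) (K.map (↑)) x i).im)
      = K *ᵥ fun i => (x i).im := by
    funext i
    simp [Matrix.mulVec, dotProduct]
  rw [mul_pow, hpyth, hpyth x, h1, h2, mul_add, ← mul_pow, ← mul_pow]
  gcongr <;> exact hK _

/-- The complex matrix `diag (e ^ (z α)) K diag (e ^ (z β))`. When `α` and `β` are the logarithms of
the eigenvalues of `A` and `B`, and `K` is the matrix of inner products of their eigenvectors, this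
is `A ^ z B ^ z` written in the two eigenbases. -/
noncomputable def expSandwich {ι : Type*} [Fintype ι] [DecidableEq ι] (K : Matrix ι ι ℝ)
    (α β : ι → ℝ) (z : ℂ) : Matrix ι ι ℂ :=
  Matrix.diagonal (fun i => Complex.exp (z * α i)) * K.map ((↑) : ℝ → ℂ) *
    Matrix.diagonal (fun j => Complex.exp (z * β j))

section Sandwich

variable {ι : Type*} [Fintype ι] [DecidableEq ι]

theorem expSandwich_apply (K : Matrix ι ι ℝ) (α β : ι → ℝ) (z : ℂ) (i j : ι) :
    expSandwich K α β z i j = K i j * Complex.exp (z * (α i + β j : ℝ)) := by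
  rw [expSandwich, Matrix.mul_diagonal, Matrix.diagonal_mul, Matrix.map_apply]
  push_cast
  rw [mul_add, Complex.exp_add]
  ring

theorem expSandwich_ofReal (K : Matrix ι ι ℝ) (α β : ι → ℝ) (s : ℝ) :
    expSandwich K α β s = (Matrix.diagonal (fun i => Real.exp (s * α i)) * K *
      Matrix.diagonal (fun j => Real.exp (s * β j))).map ((↑) : ℝ → ℂ) := by
  ext i j
  rw [expSandwich_apply, Matrix.map_apply, Matrix.mul_diagonal, Matrix.diagonal_mul]
  push_cast
  rw [mul_add, Complex.exp_add]
  ring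

theorem expSandwich_add (K : Matrix ι ι ℝ) (α β : ι → ℝ) (z w : ℂ) :
    expSandwich K α β (z + w) = Matrix.diagonal (fun i => Complex.exp (w * α i)) *
      expSandwich K α β z * Matrix.diagonal (fun j => Complex.exp (w * β j)) := by
  ext i j
  rw [Matrix.mul_diagonal, Matrix.diagonal_mul, expSandwich_apply, expSandwich_apply]
  push_cast
  rw [add_mul, Complex.exp_add, mul_add w, Complex.exp_add]
  ring

theorem norm_diagonal_exp_le (α : ι → ℝ) (z : ℂ) (C : ℝ) (hC : ∀ i, z.re * α i ≤ C) :
    ‖Matrix.diagonal (fun i => Complex.exp (z * α i))‖ ≤ Real.exp C := by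
  rw [Matrix.l2_opNorm_diagonal, pi_norm_le_iff_of_nonneg (Real.exp_pos _).le]
  intro i
  rw [Complex.norm_exp]
  simpa using hC i

/-- Along a vertical line the matrix changes only by unitary diagonal factors, so a bound at the
real point of the line holds on all of it. -/
theorem norm_expSandwich_le_of_re_eq {K : Matrix ι ι ℝ} {α β : ι → ℝ} {x : ℝ}
    (h : ‖expSandwich K α β x‖ ≤ 1) {z : ℂ} (hz : z.re = x) : ‖expSandwich K α β z‖ ≤ 1 := by
  have hz' : z = (x : ℂ) + z.im * Complex.I := by rw [← hz, Complex.re_add_im]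
  have hd : ∀ γ : ι → ℝ,
      ‖Matrix.diagonal (fun i => Complex.exp (z.im * Complex.I * γ i))‖ ≤ 1 := by
    intro γ
    simpa using norm_diagonal_exp_le γ (z.im * Complex.I) 0 (by simp)
  rw [hz', expSandwich_add]
  calc _ ≤ _ := norm_mul_le _ _
    _ ≤ (1 * 1) * 1 := by
      gcongr
      · exact (norm_mul_le _ _).trans (by gcongr; exact hd α)
      · exact hd β
    _ = 1 := by norm_num

theorem differentiable_toEuclideanCLM_expSandwich (K : Matrix ι ι ℝ) (α β : ι → ℝ)
    (x : EuclideanSpace ℂ ι) :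
    Differentiable ℂ fun z => Matrix.toEuclideanCLM (n := ι) (𝕜 := ℂ) (expSandwich K α β z) x := by
  rw [differentiable_euclidean]
  intro i
  simp only [Matrix.ofLp_toEuclideanCLM, Matrix.mulVec, dotProduct, expSandwich_apply]
  fun_prop

open Complex.HadamardThreeLines in
/-- Complex form of `‖A ^ s B ^ s‖ ≤ ‖A B‖ ^ s`, by the three lines theorem. -/
theorem norm_expSandwich_le_one {K : Matrix ι ι ℝ} {α β : ι → ℝ} (h0 : ‖K‖ ≤ 1)
    (h1 : ‖Matrix.diagonal (fun i => Real.exp (α i)) * K *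
      Matrix.diagonal (fun j => Real.exp (β j))‖ ≤ 1) {z : ℂ} (hz : z.re ∈ Set.Icc (0 : ℝ) 1) :
    ‖expSandwich K α β z‖ ≤ 1 := by
  have hE0 : ‖expSandwich K α β (0 : ℝ)‖ ≤ 1 := by
    rw [expSandwich_ofReal]
    refine (norm_map_ofReal_le _).trans ?_
    simpa [Matrix.diagonal_one] using h0
  have hE1 : ‖expSandwich K α β (1 : ℝ)‖ ≤ 1 := by
    rw [expSandwich_ofReal]
    refine (norm_map_ofReal_le _).trans ?_
    simpa using h1
  rw [← Matrix.l2_opNorm_toEuclideanCLM]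
  refine ContinuousLinearMap.opNorm_le_bound _ zero_le_one fun x => ?_
  have hbd : ∀ w : ℂ, ‖Matrix.toEuclideanCLM (n := ι) (𝕜 := ℂ) (expSandwich K α β w) x‖
      ≤ ‖expSandwich K α β w‖ * ‖x‖ := fun w => by
    rw [← Matrix.l2_opNorm_toEuclideanCLM]
    exact ContinuousLinearMap.le_opNorm _ _
  have hbd1 : ∀ w : ℂ, ‖expSandwich K α β w‖ ≤ 1 →
      ‖Matrix.toEuclideanCLM (n := ι) (𝕜 := ℂ) (expSandwich K α β w) x‖ ≤ ‖x‖ := fun w hw =>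
    (hbd w).trans (by simpa using mul_le_mul_of_nonneg_right hw (norm_nonneg x))
  have key := norm_le_interp_of_mem_verticalClosedStrip₀₁'
    (fun z => Matrix.toEuclideanCLM (n := ι) (𝕜 := ℂ) (expSandwich K α β z) x) (z := z)
    (a := ‖x‖) (b := ‖x‖) hz
    (differentiable_toEuclideanCLM_expSandwich K α β x).diffContOnCl ?_
    (fun w hw => hbd1 w (norm_expSandwich_le_of_re_eq hE0 hw))
    (fun w hw => hbd1 w (norm_expSandwich_le_of_re_eq hE1 hw))
  · rcases eq_or_ne x 0 with rfl | hx
    · simp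
    · rwa [← Real.rpow_add (norm_pos_iff.2 hx), sub_add_cancel, Real.rpow_one, ← one_mul ‖x‖] at key
  · refine ⟨Real.exp (∑ i, |α i|) * ‖K.map ((↑) : ℝ → ℂ)‖ * Real.exp (∑ i, |β i|) * ‖x‖, ?_⟩
    rintro _ ⟨w, hw, rfl⟩
    have hd : ∀ γ : ι → ℝ,
        ‖Matrix.diagonal (fun i => Complex.exp (w * γ i))‖ ≤ Real.exp (∑ i, |γ i|) := by
      intro γ
      refine norm_diagonal_exp_le γ w _ fun i => ?_
      have hw' : 0 ≤ w.re ∧ w.re ≤ 1 := hw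
      calc w.re * γ i ≤ w.re * |γ i| := by gcongr; exacts [hw'.1, le_abs_self _]
        _ ≤ 1 * |γ i| := by gcongr; exact hw'.2
        _ ≤ _ := by
          rw [one_mul]
          exact Finset.single_le_sum (f := fun i => |γ i|) (fun _ _ => abs_nonneg _)
            (Finset.mem_univ i)
    refine (hbd w).trans ?_
    gcongr
    refine (norm_mul_le _ _).trans ?_
    gcongr
    · exact (norm_mul_le _ _).trans (by gcongr; exact hd α)
    · exact hd β

open Complex in
/-- If the contraction `E(s)` preserves the norm of `x`, the holomorphic map `z ↦ E(z) x` has maximal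
norm at `s`, so it is constant on the strip; then every nonzero exponent drops out of the exponential
sums that are its coordinates. -/
theorem sum_fiber_eq_zero_of_norm_expSandwich_eq {K : Matrix ι ι ℝ} {α β : ι → ℝ}
    (h0 : ‖K‖ ≤ 1) (h1 : ‖Matrix.diagonal (fun i => Real.exp (α i)) * K *
      Matrix.diagonal (fun j => Real.exp (β j))‖ ≤ 1) {s : ℝ} (hs : s ∈ Set.Ioo (0 : ℝ) 1)
    {x : EuclideanSpace ℂ ι}
    (hx : ‖Matrix.toEuclideanCLM (n := ι) (𝕜 := ℂ) (expSandwich K α β s) x‖ = ‖x‖)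
    (i : ι) {w : ℝ} (hw : w ≠ 0) : ∑ j with α i + β j = w, (K i j : ℂ) * x j = 0 := by
  set g : ℂ → EuclideanSpace ℂ ι :=
    fun z => Matrix.toEuclideanCLM (n := ι) (𝕜 := ℂ) (expSandwich K α β z) x with hg
  have hconst : Set.EqOn g (Function.const ℂ (g s)) (re ⁻¹' Set.Ioo 0 1) := by
    refine eqOn_of_isPreconnected_of_isMaxOn_norm
      ((convex_Ioo (0 : ℝ) 1).linear_preimage reLm).isPreconnected
      (isOpen_Ioo.preimage continuous_re)
      (differentiable_toEuclideanCLM_expSandwich K α β x).differentiableOn (by simpa using hs) ?_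
    intro z hz
    have := norm_expSandwich_le_one h0 h1 (z := z) (Set.Ioo_subset_Icc_self hz)
    simp only [Function.comp, Set.mem_ofPred_eq, hg, hx]
    rw [← Matrix.l2_opNorm_toEuclideanCLM] at this
    exact (ContinuousLinearMap.le_of_opNorm_le _ this x).trans_eq (one_mul _)
  have key := sum_fiber_eq_zero_of_expSum_const
    (fun j => (K i j : ℂ) * exp (s * (α i + β j : ℝ)) * x j) (fun j => α i + β j) (g s i) ?_ hw
  · have hsum : ∑ j with α i + β j = w, (K i j : ℂ) * exp (s * (α i + β j : ℝ)) * x j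
        = exp (s * w) * ∑ j with α i + β j = w, (K i j : ℂ) * x j := by
      rw [Finset.mul_sum]
      refine Finset.sum_congr rfl fun j hj => ?_
      rw [(Finset.mem_filter.1 hj).2]
      ring
    rw [hsum] at key
    exact (mul_eq_zero.1 key).resolve_left (exp_ne_zero _)
  · intro τ
    have h2 : g (s + τ * I) = g s := hconst (by simpa using hs)
    rw [← h2]
    simp only [hg, Matrix.ofLp_toEuclideanCLM, Matrix.mulVec, dotProduct, expSandwich_apply]
    refine Finset.sum_congr rfl fun j _ => ?_
    rw [add_mul, exp_add]
    ring

open Complex in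
/-- Gap estimate: if all the numbers `2 α i + β j + β j'` stay away from `0`, then `E(s)` is a strict
contraction on real vectors, with a factor that depends only on the size, on `s` and on the gap.
The entire function `F(z) = ∑ i, (E(z) x) i ^ 2` is an exponential sum with just these frequencies
and `Re F ≤ ‖x‖ ^ 2` on the strip. Its real part is nonpositive somewhere on a segment of controlled
length above `s`, and Harnack's inequality carries the loss back to `s`, where
`F(s) = ‖E(s) x‖ ^ 2` because `x` is real. -/
theorem norm_sq_expSandwich_mulVec_le {K : Matrix ι ι ℝ} {α β : ι → ℝ}
    (h0 : ‖K‖ ≤ 1) (h1 : ‖Matrix.diagonal (fun i => Real.exp (α i)) * K *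
      Matrix.diagonal (fun j => Real.exp (β j))‖ ≤ 1) {s r δ : ℝ} (hr : 0 < r) (hrs : r ≤ s)
    (hrs' : r ≤ 1 - s) (hδ : 0 < δ) (hgap : ∀ i j j', δ ≤ |2 * α i + β j + β j'|) {k : ℕ}
    (hk : (Fintype.card ι : ℝ) ^ 3 * (Real.pi / δ) ≤ k * (r / 2)) (y : ι → ℝ) :
    ‖WithLp.toLp 2 ((Matrix.diagonal (fun i => Real.exp (s * α i)) * K *
      Matrix.diagonal (fun j => Real.exp (s * β j))) *ᵥ y)‖ ^ 2
      ≤ (1 - (3 ^ k)⁻¹) * ‖WithLp.toLp 2 y‖ ^ 2 := by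
  set x : EuclideanSpace ℂ ι := WithLp.toLp 2 fun i => (y i : ℂ) with hx
  set F : ℂ → ℂ := fun z =>
    ∑ i, (Matrix.toEuclideanCLM (n := ι) (𝕜 := ℂ) (expSandwich K α β z) x i) ^ 2 with hF
  have hFexp : ∀ z, F z = ∑ p : ι × ι × ι, K p.1 p.2.1 * y p.2.1 * (K p.1 p.2.2 * y p.2.2) *
      exp (z * (2 * α p.1 + β p.2.1 + β p.2.2 : ℝ)) := by
    intro z
    simp only [hF, Matrix.ofLp_toEuclideanCLM, Matrix.mulVec, dotProduct, expSandwich_apply, sq,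
      Finset.sum_mul_sum, Fintype.sum_prod_type]
    refine Finset.sum_congr rfl fun i _ => Finset.sum_congr rfl fun j _ =>
      Finset.sum_congr rfl fun j' _ => ?_
    rw [show (z * (2 * α i + β j + β j' : ℝ) : ℂ)
      = z * (α i + β j : ℝ) + z * (α i + β j' : ℝ) by push_cast; ring, exp_add]
    ring
  have hFd : Differentiable ℂ fun z => (‖x‖ ^ 2 : ℂ) - F z := by
    simp only [hFexp]
    fun_prop
  have hFle : ∀ z : ℂ, |z.re - s| < r → 0 ≤ ((‖x‖ ^ 2 : ℂ) - F z).re := by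
    intro z hz
    rw [abs_lt] at hz
    have hE := norm_expSandwich_le_one h0 h1 (z := z) ⟨by linarith, by linarith⟩
    rw [← Matrix.l2_opNorm_toEuclideanCLM] at hE
    have hE' := ContinuousLinearMap.le_of_opNorm_le _ hE x
    rw [one_mul] at hE'
    have : (F z).re ≤ ‖x‖ ^ 2 := calc
      (F z).re ≤ ‖F z‖ := re_le_norm _
      _ ≤ ∑ i, ‖Matrix.toEuclideanCLM (n := ι) (𝕜 := ℂ) (expSandwich K α β z) x i‖ ^ 2 := by
        refine (norm_sum_le _ _).trans_eq ?_
        simp only [norm_pow]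
      _ = ‖Matrix.toEuclideanCLM (n := ι) (𝕜 := ℂ) (expSandwich K α β z) x‖ ^ 2 :=
        (EuclideanSpace.norm_sq_eq _).symm
      _ ≤ ‖x‖ ^ 2 := by gcongr
    rw [← ofReal_pow, sub_re, ofReal_re]
    linarith
  obtain ⟨τ, hτ0, hτ1, hτ⟩ := exists_re_expSum_nonpos (Finset.univ : Finset (ι × ι × ι))
    (fun p => 2 * α p.1 + β p.2.1 + β p.2.2) hδ (fun p _ => hgap _ _ _)
    (fun p => K p.1 p.2.1 * y p.2.1 * (K p.1 p.2.2 * y p.2.2) *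
      exp (s * (2 * α p.1 + β p.2.1 + β p.2.2 : ℝ)))
  have hFτ : (F (s + τ * I)).re ≤ 0 := by
    convert hτ using 2
    rw [hFexp]
    refine Finset.sum_congr rfl fun p _ => ?_
    rw [add_mul, exp_add]
    ring
  have hcard : τ ≤ k * (r / 2) := by
    refine hτ1.trans (le_trans (le_of_eq ?_) hk)
    simp only [Finset.card_univ, Fintype.card_prod]
    push_cast
    ring
  have hharn := re_le_three_pow_mul_re hFd hr hFle k 0 τ (by rwa [abs_of_nonneg hτ0])
  have hFs : (F s).re = ‖WithLp.toLp 2 ((Matrix.diagonal (fun i => Real.exp (s * α i)) * K *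
      Matrix.diagonal (fun j => Real.exp (s * β j))) *ᵥ y)‖ ^ 2 := by
    rw [EuclideanSpace.norm_sq_eq]
    simp only [hF, expSandwich_ofReal, hx, Matrix.toEuclideanCLM_toLp, map_ofReal_mulVec]
    rw [re_sum]
    refine Finset.sum_congr rfl fun i _ => ?_
    rw [Real.norm_eq_abs, sq_abs, ← ofReal_pow, ofReal_re]
  have hxy : ‖x‖ = ‖WithLp.toLp 2 y‖ := norm_toLp_ofReal y
  rw [← hFs, ← hxy]
  simp only [zero_add, ofReal_zero, zero_mul, add_zero, ← ofReal_pow, sub_re, ofReal_re] at hharn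
  have h3 : (0 : ℝ) < 3 ^ k := by positivity
  have h4 : (3 ^ k : ℝ)⁻¹ * ‖x‖ ^ 2 ≤ ‖x‖ ^ 2 - (F s).re := by
    rw [inv_mul_le_iff₀ h3]
    linarith
  linarith

end Sandwich

/-! ### Diagonalization of a pair of positive definite matrices -/

section Diagonalize

variable {n : ℕ} {A B : Matrix (Fin n) (Fin n) ℝ}

theorem exp_mul_log_eigenvalues (hA : A.PosDef) (s : ℝ) (i : Fin n) :
    Real.exp (s * Real.log (hA.isHermitian.eigenvalues i)) = hA.isHermitian.eigenvalues i ^ s := by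
  rw [Real.rpow_def_of_pos (hA.eigenvalues_pos i), mul_comm]

theorem matPow_eq (hA : A.PosDef) (s : ℝ) :
    matPow A s = hA.isHermitian.eigenvectorUnitary *
      Matrix.diagonal (fun i => Real.exp (s * Real.log (hA.isHermitian.eigenvalues i))) *
      star (hA.isHermitian.eigenvectorUnitary : Matrix (Fin n) (Fin n) ℝ) := by
  rw [matPow, hA.isHermitian.cfc_eq, Matrix.IsHermitian.cfc, Unitary.conjStarAlgAut_apply]
  congr 3
  funext i
  exact (exp_mul_log_eigenvalues hA s i).symm

theorem matPow_one (hA : A.PosDef) : matPow A 1 = A := by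
  simp only [matPow, Real.rpow_one]
  exact cfc_id' ℝ A hA.isHermitian.isSelfAdjoint

/-- The matrix of inner products `⟨aᵢ, bⱼ⟩` of the eigenvectors of `A` and `B` (Mathlib's chosen
orthonormal eigenbases). -/
noncomputable def overlap (hA : A.PosDef) (hB : B.PosDef) : Matrix (Fin n) (Fin n) ℝ :=
  star (hA.isHermitian.eigenvectorUnitary : Matrix (Fin n) (Fin n) ℝ) *
    hB.isHermitian.eigenvectorUnitary

theorem norm_unitary_le_one (U : Matrix.unitaryGroup (Fin n) ℝ) :
    ‖(U : Matrix (Fin n) (Fin n) ℝ)‖ ≤ 1 := by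
  rcases Nat.eq_zero_or_pos n with rfl | hn
  · simp [Subsingleton.elim (_ : Matrix (Fin 0) (Fin 0) ℝ) 0]
  · have : NeZero n := ⟨hn.ne'⟩
    exact (CStarRing.norm_coe_unitary U).le

theorem norm_overlap_le (hA : A.PosDef) (hB : B.PosDef) : ‖overlap hA hB‖ ≤ 1 :=
  norm_unitary_le_one (star hA.isHermitian.eigenvectorUnitary * hB.isHermitian.eigenvectorUnitary)

theorem overlap_apply (hA : A.PosDef) (hB : B.PosDef) (i j : Fin n) :
    overlap hA hB i j = inner ℝ (hA.isHermitian.eigenvectorBasis i)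
      (hB.isHermitian.eigenvectorBasis j) := by
  simp [overlap, Matrix.mul_apply, PiLp.inner_apply, Matrix.star_apply, mul_comm]

theorem matPow_mul_matPow_eq (hA : A.PosDef) (hB : B.PosDef) (s : ℝ) :
    matPow A s * matPow B s = hA.isHermitian.eigenvectorUnitary *
      (Matrix.diagonal (fun i => Real.exp (s * Real.log (hA.isHermitian.eigenvalues i))) *
      overlap hA hB *
      Matrix.diagonal (fun i => Real.exp (s * Real.log (hB.isHermitian.eigenvalues i)))) *
      star (hB.isHermitian.eigenvectorUnitary : Matrix (Fin n) (Fin n) ℝ) := by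
  rw [matPow_eq hA, matPow_eq hB, overlap]
  simp only [mul_assoc]

theorem norm_matPow_mul_matPow (hA : A.PosDef) (hB : B.PosDef) (s : ℝ) :
    ‖matPow A s * matPow B s‖ =
      ‖Matrix.diagonal (fun i => Real.exp (s * Real.log (hA.isHermitian.eigenvalues i))) *
      overlap hA hB *
      Matrix.diagonal (fun i => Real.exp (s * Real.log (hB.isHermitian.eigenvalues i)))‖ := by
  rw [matPow_mul_matPow_eq, ← Unitary.coe_star, CStarRing.norm_mul_coe_unitary,
    CStarRing.norm_coe_unitary_mul]

theorem norm_exp_log_sandwich_le_one (hA : A.PosDef) (hB : B.PosDef) (h : ‖A * B‖ = 1) :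
    ‖Matrix.diagonal (fun i => Real.exp (Real.log (hA.isHermitian.eigenvalues i))) *
      overlap hA hB *
      Matrix.diagonal (fun i => Real.exp (Real.log (hB.isHermitian.eigenvalues i)))‖ ≤ 1 := by
  have := norm_matPow_mul_matPow hA hB 1
  simp only [matPow_one hA, matPow_one hB, h, one_mul] at this
  exact this.symm.le

theorem norm_unitary_mulVec (U : Matrix.unitaryGroup (Fin n) ℝ) (v : Fin n → ℝ) :
    ‖WithLp.toLp 2 ((U : Matrix (Fin n) (Fin n) ℝ) *ᵥ v)‖ = ‖WithLp.toLp 2 v‖ := by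
  have hle : ∀ (W : Matrix.unitaryGroup (Fin n) ℝ) (v : Fin n → ℝ),
      ‖WithLp.toLp 2 ((W : Matrix (Fin n) (Fin n) ℝ) *ᵥ v)‖ ≤ ‖WithLp.toLp 2 v‖ := by
    intro W v
    refine (Matrix.l2_opNorm_mulVec (W : Matrix (Fin n) (Fin n) ℝ) (WithLp.toLp 2 v)).trans ?_
    exact mul_le_of_le_one_left (norm_nonneg _) (norm_unitary_le_one W)
  refine le_antisymm (hle U v) ?_
  simpa using hle (star U) ((U : Matrix (Fin n) (Fin n) ℝ) *ᵥ v)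

theorem toEuclideanCLM_eigenvectorBasis (hA : A.IsHermitian) (i : Fin n) :
    Matrix.toEuclideanCLM (n := Fin n) (𝕜 := ℝ) A (hA.eigenvectorBasis i)
      = hA.eigenvalues i • hA.eigenvectorBasis i :=
  congrArg (WithLp.toLp 2) (hA.mulVec_eigenvectorBasis i)

theorem specProj_eq_sum (hB : B.PosDef) (μ : ℝ) (v : EuclideanSpace ℝ (Fin n)) :
    specProj B μ v = ∑ j with hB.isHermitian.eigenvalues j = μ,
      inner ℝ (hB.isHermitian.eigenvectorBasis j) v • hB.isHermitian.eigenvectorBasis j := by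
  set b := hB.isHermitian.eigenvectorBasis
  have hb : ∀ j, Matrix.toEuclideanCLM (n := Fin n) (𝕜 := ℝ) B (b j)
      = hB.isHermitian.eigenvalues j • b j := toEuclideanCLM_eigenvectorBasis hB.isHermitian
  refine Submodule.eq_starProjection_of_mem_of_inner_eq_zero
    (Submodule.sum_mem _ fun j hj => Submodule.smul_mem _ _ ?_) fun w hw => ?_
  · rw [Module.End.mem_eigenspace_iff]
    exact (hb j).trans (by rw [(Finset.mem_filter.1 hj).2])
  · rw [Module.End.mem_eigenspace_iff] at hw
    replace hw : Matrix.toEuclideanCLM (n := Fin n) (𝕜 := ℝ) B w = μ • w := hw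
    have hsa : IsSelfAdjoint (Matrix.toEuclideanCLM (n := Fin n) (𝕜 := ℝ) B) :=
      hB.isHermitian.isSelfAdjoint.map _
    have horth : ∀ j, hB.isHermitian.eigenvalues j ≠ μ → inner ℝ (b j) w = 0 := by
      intro j hj
      have h1 := hsa.isSymmetric (b j) w
      simp only [ContinuousLinearMap.coe_coe] at h1
      rw [hb, hw, inner_smul_left, inner_smul_right] at h1
      have h2 : (hB.isHermitian.eigenvalues j - μ) * inner ℝ (b j) w = 0 := by
        rw [sub_mul]; exact sub_eq_zero.2 h1
      exact (mul_eq_zero.1 h2).resolve_left (sub_ne_zero.2 hj)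
    rw [inner_sub_left, sum_inner, sub_eq_zero, ← b.sum_inner_mul_inner v w,
      Finset.sum_filter_of_ne]
    · refine Finset.sum_congr rfl fun j _ => ?_
      rw [inner_smul_left, real_inner_comm]
      rfl
    · intro j _ hj
      by_contra hne
      exact hj (by rw [inner_smul_left, horth j hne, mul_zero])

/-! ### The equality case and the gap -/

theorem norm_matPow_mul_matPow_le (hA : A.PosDef) (hB : B.PosDef) (h : ‖A * B‖ = 1)
    {s r δ : ℝ} (hr : 0 < r) (hrs : r ≤ s) (hrs' : r ≤ 1 - s) (hδ : 0 < δ)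
    (hgap : ∀ l ∈ spectrum ℝ A, ∀ m ∈ spectrum ℝ B, ∀ m' ∈ spectrum ℝ B,
      δ ≤ |2 * Real.log l + Real.log m + Real.log m'|) {k : ℕ}
    (hk : (n : ℝ) ^ 3 * (Real.pi / δ) ≤ k * (r / 2)) :
    ‖matPow A s * matPow B s‖ ≤ 1 - (3 ^ k)⁻¹ / 2 := by
  -- The gap estimate bounds the square of the norm; `√(1 - ε) ≤ 1 - ε / 2` accounts for the half.
  have h3 : (3 ^ k : ℝ)⁻¹ ≤ 1 := inv_le_one_of_one_le₀ (one_le_pow₀ (by norm_num))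
  have h3' : (0 : ℝ) < (3 ^ k)⁻¹ := by positivity
  rw [norm_matPow_mul_matPow hA hB, ← Matrix.l2_opNorm_toEuclideanCLM]
  refine ContinuousLinearMap.opNorm_le_bound _ (by linarith) fun x => ?_
  have key := norm_sq_expSandwich_mulVec_le (norm_overlap_le hA hB)
    (norm_exp_log_sandwich_le_one hA hB h) hr hrs hrs' hδ
    (fun i j j' => hgap _ (hA.isHermitian.eigenvalues_mem_spectrum_real i) _
      (hB.isHermitian.eigenvalues_mem_spectrum_real j) _
      (hB.isHermitian.eigenvalues_mem_spectrum_real j')) (by simpa using hk) (WithLp.ofLp x)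
  refine (sq_le_sq₀ (norm_nonneg _) (mul_nonneg (by linarith) (norm_nonneg _))).1
    (le_trans key ?_)
  rw [mul_pow]
  refine mul_le_mul_of_nonneg_right ?_ (by positivity)
  nlinarith [sq_nonneg (3 ^ k : ℝ)⁻¹]

theorem hasEigenvector_specProj (hA : A.PosDef) (hB : B.PosDef) (h : ‖A * B‖ = 1) {s : ℝ}
    (hs : s ∈ Set.Ioo (0 : ℝ) 1) {v : EuclideanSpace ℝ (Fin n)}
    (hv : ‖Matrix.toEuclideanCLM (n := Fin n) (𝕜 := ℝ) (matPow A s * matPow B s) v‖ = ‖v‖)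
    {μ : ℝ} (hμ : specProj B μ v ≠ 0) :
    Module.End.HasEigenvector
      (Matrix.toEuclideanCLM (n := Fin n) (𝕜 := ℝ) A).toLinearMap (1 / μ) (specProj B μ v) := by
  set a := hA.isHermitian.eigenvectorBasis
  set b := hB.isHermitian.eigenvectorBasis with hb
  have hμ0 : 0 < μ := by
    by_contra hle
    refine hμ ((specProj_eq_sum hB μ v).trans (Finset.sum_eq_zero fun j hj => ?_))
    have := hB.eigenvalues_pos j
    rw [(Finset.mem_filter.1 hj).2] at this
    exact absurd this hle
  set V := hB.isHermitian.eigenvectorUnitary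
  set y : Fin n → ℝ := (star (V : Matrix (Fin n) (Fin n) ℝ)) *ᵥ WithLp.ofLp v with hy
  have hyj : ∀ j, y j = inner ℝ (b j) v := by
    intro j
    simp [hy, V, hb, Matrix.mulVec, dotProduct, PiLp.inner_apply, Matrix.star_apply, mul_comm]
  have hynorm : ‖WithLp.toLp 2 y‖ = ‖v‖ := norm_unitary_mulVec (star V) (WithLp.ofLp v)
  set α : Fin n → ℝ := fun i => Real.log (hA.isHermitian.eigenvalues i)
  set β : Fin n → ℝ := fun i => Real.log (hB.isHermitian.eigenvalues i)
  set x : EuclideanSpace ℂ (Fin n) := WithLp.toLp 2 fun j => (y j : ℂ) with hx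
  have hnorm : ‖Matrix.toEuclideanCLM (n := Fin n) (𝕜 := ℂ)
      (expSandwich (overlap hA hB) α β s) x‖ = ‖x‖ := by
    rw [hx, norm_toLp_ofReal, hynorm, ← hv, Matrix.toEuclideanCLM_toLp, expSandwich_ofReal,
      map_ofReal_mulVec, norm_toLp_ofReal, matPow_mul_matPow_eq hA hB,
      ← norm_unitary_mulVec hA.isHermitian.eigenvectorUnitary, hy, Matrix.mulVec_mulVec,
      Matrix.mulVec_mulVec]
    rfl
  -- The `i`-th coordinate of `E(z) y` has the frequencies `log (λᵢ μⱼ)`; those with `μⱼ = μ` carry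
  -- the coefficients of `⟨aᵢ, π_μ v⟩`, which therefore vanishes unless `λᵢ μ = 1`.
  have hfib : ∀ i, hA.isHermitian.eigenvalues i ≠ 1 / μ → inner ℝ (a i) (specProj B μ v) = 0 := by
    intro i hi
    have hw : α i + Real.log μ ≠ 0 := by
      intro h0
      apply hi
      have h0' : Real.log (hA.isHermitian.eigenvalues i) = -Real.log μ :=
        eq_neg_of_add_eq_zero_left h0
      rw [← Real.exp_log (hA.eigenvalues_pos i), h0', Real.exp_neg, Real.exp_log hμ0, one_div]
    have h1 := sum_fiber_eq_zero_of_norm_expSandwich_eq (norm_overlap_le hA hB)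
      (norm_exp_log_sandwich_le_one hA hB h) hs hnorm i hw
    have h2 : ∀ j, α i + β j = α i + Real.log μ ↔ hB.isHermitian.eigenvalues j = μ := fun j =>
      (add_right_inj _).trans
        ⟨fun h => Real.log_injOn_pos (hB.eigenvalues_pos j) hμ0 h, fun h => congrArg Real.log h⟩
    rw [Finset.filter_congr fun j _ => h2 j] at h1
    rw [specProj_eq_sum hB, inner_sum]
    have h3 : ((∑ j with hB.isHermitian.eigenvalues j = μ, overlap hA hB i j * y j : ℝ) : ℂ) = 0 := by
      push_cast
      exact h1
    rw [← Complex.ofReal_eq_zero.1 h3]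
    refine Finset.sum_congr rfl fun j _ => ?_
    rw [inner_smul_right, overlap_apply, hyj, mul_comm]
  refine Module.End.hasEigenvector_iff.2 ⟨Module.End.mem_eigenspace_iff.2 ?_, hμ⟩
  set p := specProj B μ v
  change Matrix.toEuclideanCLM (n := Fin n) (𝕜 := ℝ) A p = (1 / μ) • p
  conv_lhs => rw [← a.sum_repr' p]
  conv_rhs => rw [← a.sum_repr' p]
  rw [map_sum, Finset.smul_sum]
  refine Finset.sum_congr rfl fun i _ => ?_
  rw [map_smul, toEuclideanCLM_eigenvectorBasis]
  by_cases hi : hA.isHermitian.eigenvalues i = 1 / μ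
  · rw [hi, smul_comm]
  · rw [hfib i hi, zero_smul, zero_smul, smul_zero]

theorem norm_matPow_mul_comm (A B : Matrix (Fin n) (Fin n) ℝ) (s : ℝ) :
    ‖matPow A s * matPow B s‖ = ‖matPow B s * matPow A s‖ := by
  have hsa : ∀ C : Matrix (Fin n) (Fin n) ℝ, star (matPow C s) = matPow C s := fun C =>
    (cfc_predicate (fun x : ℝ => x ^ s) C : IsSelfAdjoint _)
  rw [← norm_star, star_mul, hsa, hsa]

end Diagonalize

theorem theorem3 (n : ℕ) (s : ℝ) (hs0 : 0 < s) (hs1 : s < 1) :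
    (∀ A B : Matrix (Fin n) (Fin n) ℝ, A.PosDef → B.PosDef → ‖A * B‖ = 1 →
      ∀ v : EuclideanSpace ℝ (Fin n), ‖v‖ = 1 →
        ‖Matrix.toEuclideanCLM (n := Fin n) (𝕜 := ℝ) (matPow A s * matPow B s) v‖ = 1 →
        ∀ μ : ℝ, specProj B μ v ≠ 0 →
          Module.End.HasEigenvector
            (Matrix.toEuclideanCLM (n := Fin n) (𝕜 := ℝ) A).toLinearMap (1 / μ)
            (specProj B μ v)) ∧
    (∀ d : ℝ, 0 < d → ∃ c : ℝ, 0 < c ∧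
      ∀ A B : Matrix (Fin n) (Fin n) ℝ, A.PosDef → B.PosDef → ‖A * B‖ = 1 → dStar A B = d →
        ‖matPow A s * matPow B s‖ ≤ (1 - c) * ‖A * B‖ ^ s) := by
  refine ⟨fun A B hA hB h v hv hvs μ hμ =>
    hasEigenvector_specProj hA hB h ⟨hs0, hs1⟩ (hvs.trans hv.symm) hμ, fun d hd => ?_⟩
  set r := min s (1 - s)
  have hr : 0 < r := lt_min hs0 (by linarith)
  obtain ⟨k, hk⟩ := exists_nat_ge ((n : ℝ) ^ 3 * (Real.pi / (d / 2)) / (r / 2))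
  rw [div_le_iff₀ (by positivity)] at hk
  refine ⟨(3 ^ k)⁻¹ / 2, by positivity, fun A B hA hB h hdd => ?_⟩
  rw [h, Real.one_rpow, mul_one]
  rw [dStar] at hdd
  -- One of the two minima is at least `d / 2`. The second one is the gap for `A B`, the first one
  -- is the gap for `B A`, and `‖A ^ s B ^ s‖ = ‖B ^ s A ^ s‖`.
  rcases le_or_gt (d / 2) (sInf {x : ℝ | ∃ l ∈ spectrum ℝ A, ∃ m ∈ spectrum ℝ B,
    ∃ m' ∈ spectrum ℝ B, x = |2 * Real.log l + Real.log m + Real.log m'|}) with h2 | h2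
  · refine norm_matPow_mul_matPow_le hA hB h hr (min_le_left _ _) (min_le_right _ _)
      (half_pos hd) (fun l hl m hm m' hm' => h2.trans (csInf_le ⟨0, ?_⟩ ⟨l, hl, m, hm, m', hm', rfl⟩))
      hk
    rintro _ ⟨_, _, _, _, _, _, rfl⟩
    exact abs_nonneg _
  · rw [norm_matPow_mul_comm A B]
    have h' : ‖B * A‖ = 1 := by
      rw [← h, ← norm_star, star_mul, hA.isHermitian.isSelfAdjoint.star_eq,
        hB.isHermitian.isSelfAdjoint.star_eq]
    refine norm_matPow_mul_matPow_le hB hA h' hr (min_le_left _ _) (min_le_right _ _)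
      (half_pos hd) (fun m hm l hl l' hl' => ?_) hk
    have h1 : d / 2 ≤ sInf {x : ℝ | ∃ l ∈ spectrum ℝ A, ∃ l' ∈ spectrum ℝ A, ∃ m ∈ spectrum ℝ B,
      x = |Real.log l + Real.log l' + 2 * Real.log m|} := by linarith
    refine h1.trans (csInf_le ⟨0, ?_⟩ ⟨l, hl, l', hl', m, hm, ?_⟩)
    · rintro _ ⟨_, _, _, _, _, _, rfl⟩
      exact abs_nonneg _
    · congr 1; ring
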